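/- **Theorem (No UqPUF provides quantum existential unforgeability).** *Setting.* Let $n:\mathbb N\to\mathbb N$ be polynomially bounded with $n(\lambda)\ge 1$. A unitary quantum physical unclonable function (UqPUF) on $n(\lambda)$ qubits is given, for each security parameter $\lambda$, by a probability distribution $\mathrm{QGen}(\lambda)$ on devices, each device evaluating a unitary $U$ on $\mathcal H^D$, $D=2^{n(\lambda)}$. (Any such family is allowed; no uniqueness or unknownness property of the family is needed.) The fidelity of a pure state and a density matrix is $F(|\psi\rangle,\rho)=\langle\psi|\rho|\psi\rangle$. A quantum test $\mathcal T$ accepts $\kappa_1$ copies of a state and $\kappa_2$ copies of a state of fidelity $F$ with it with probability $f(\kappa_1,\kappa_2,F)$, where $f(\kappa_1,\kappa_2,F)\to 1$ as $F\to1$ (with value $1$ at $F=1$) and $f(\kappa_1,\kappa_2,F)\to \mathrm{Err}(\kappa_1,\kappa_2)$ as $F\to 0$, for all $\kappa_1,\kappa_2\ge1$, and $f(\kappa_1,\kappa_2,F)\to F$ as $\kappa_1,\kappa_2\to\infty$ for every $F\in[0,1]$. *Game with parameter $\mu$.* A device $U$ is drawn from $\mathrm{QGen}(\lambda)$. The adversary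 queries pure states $|\phi_i\rangle$ of its choice and receives $U|\phi_i\rangle$; it then chooses a pure challenge $|\phi^*\rangle$ with $F(|\phi^*\rangle,|\phi_i\rangle)\le 1-\mu$ for all $i$ (otherwise it loses), and outputs copies of a guess $\rho'$. It wins if $\mathcal T$ accepts $\kappa_1$ copies of $U|\phi^*\rangle$ and $\kappa_2$ copies of $\rho'$. The adversary does not depend on the device. It is quantum polynomial-time (QPT) if the number of its queries and the sizes of its circuits (per copy of the guess) are polynomially bounded in $\lambda$; the circuits consist of one-qubit gates and CNOTs and, in the guess phase, also of exchanges of registers and of ideal controlled reflections $|0\rangle\langle0|\otimes I+|1\rangle\langle1|\otimes(I-2|\phi\rangle\langle\phi|)$ around queried states $|\phi\rangle=|\phi_i\rangle$ and around the responses $|\phi\rangle=U|\phi_i\rangle$. A function of $\lambda$ is negligible if it is $o(\lambda^{-c})$ for every $c$, and non-negligible otherwise. *Claim.* Let $0\le\mu(\lambda)\le1$ be such that $1-\mu(\lambda)$ is non-negligible. 1. There is a QPT adversary, depending only on $n$ and $\mu$, whose challenge is always $\mu(\lambda)$-distinguishable from its queries, such that for every UqPUF on $n(\lambda)$ qubits,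 every test and all numbers of copies $\kappa_1(\lambda),\kappa_2(\lambda)\ge1$, its probability of winning the game with parameter $\mu(\lambda)$ is non-negligible. 2. Consider the following emulation attack. For orthonormal states $|\phi_1\rangle,|\phi_3\rangle$ (two computational basis states) the adversary queries $|\phi_1\rangle$ and $$|\phi_2\rangle=\begin{cases}\tfrac1{\sqrt2}(|\phi_1\rangle+|\phi_3\rangle)&\text{if }\mu\le\tfrac12,\\ \sqrt{\mu}\,|\phi_1\rangle+\sqrt{1-\mu}\,|\phi_3\rangle&\text{if }\mu>\tfrac12,\end{cases}$$ challenges with $|\phi_3\rangle$, and computes its guess by the Marvian–Lloyd quantum emulation algorithm (one block, without post-selection) with reference state $|\phi_2\rangle$ and sample state $|\phi_1\rangle$. This adversary is QPT and its challenge is $\mu$-distinguishable from its queries. For every unitary $U$, the fidelity of its guess with $U|\phi_3\rangle$ equals $1$ if $\mu\le\frac12$, and is at least $(1-\mu)(1+4\mu(1-\mu))$ if $\mu>\frac12$. Its winning probability is exactly $1$, for every test and all $\kappa_1,\kappa_2\ge1$, whenever $\mu(\lambda)\le\frac12$. In general, for every test there are thresholds $K(m)$, $m\in\mathbb R$, such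 that its winning probability is non-negligible against every UqPUF on $n(\lambda)$ qubits whenever $\kappa_1(\lambda),\kappa_2(\lambda)\ge K(\mu(\lambda))$ for all sufficiently large $\lambda$. -/

import Mathlib

open scoped Matrix
open MeasureTheory Filter Topology

noncomputable section

namespace QPUF

/-! ## Asymptotics -/

/-- A negligible function of the security parameter: it decays faster than every inverse
polynomial. -/
def Negligible (f : ℕ → ℝ) : Prop :=
  Asymptotics.SuperpolynomialDecay atTop (fun l : ℕ => (l : ℝ)) f

/-- `f` is bounded by a polynomial in the security parameter. -/
def PolyBounded (f : ℕ → ℕ) : Prop :=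
  ∃ p : Polynomial ℕ, ∀ l, f l ≤ p.eval l

/-! ## States, unitaries and fidelity

Qubits are labelled by a finite type `W`; the computational basis is `W → Bool`. A pure state of
these qubits is its vector of amplitudes, a mixed state its density matrix. -/

/-- Amplitude vectors of the qubits `W`. -/
abbrev Ket (W : Type) : Type := (W → Bool) → ℂ

/-- Unitary transformations of `n` qubits, i.e. of the Hilbert space of dimension `D = 2 ^ n`. -/
abbrev Unitary (n : ℕ) : Type := Matrix.unitaryGroup (Fin n → Bool) ℂ

/-- The density matrix `|φ⟩⟨φ|`. -/
def density {ι : Type} (φ : ι → ℂ) : Matrix ι ι ℂ := Matrix.vecMulVec φ (star φ)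

/-- The fidelity `F(|ψ⟩, ρ) = ⟨ψ|ρ|ψ⟩` of a pure state and a density matrix; it is
`|⟨ψ|φ⟩|²` if `ρ = |φ⟩⟨φ|`. -/
def fidelity {ι : Type} [Fintype ι] (ψ : ι → ℂ) (ρ : Matrix ι ι ℂ) : ℝ :=
  (star ψ ⬝ᵥ (ρ *ᵥ ψ)).re

/-- The computational basis state labelled `z`. -/
def basisKet {W : Type} [Fintype W] (z : W → Bool) : Ket W := Pi.single z 1

/-- The state `|0…0⟩`. -/
def zeroKet (W : Type) [Fintype W] : Ket W := basisKet fun _ => false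

/-! ## Elementary gates -/

/-- Elementary gates on the qubits `W`: arbitrary one-qubit gates, and CNOT. -/
inductive Gate (W : Type) : Type
  | single (w : W) (g : Matrix.unitaryGroup Bool ℂ)
  | cnot (c t : W) (h : c ≠ t)

/-- The action of a gate on amplitude vectors. -/
def Gate.apply {W : Type} [DecidableEq W] : Gate W → Ket W → Ket W
  | .single w g, ψ => fun x => ∑ b : Bool, (g : Matrix Bool Bool ℂ) (x w) b * ψ (Function.update x w b)
  | .cnot c t _, ψ => fun x => ψ (Function.update x t (xor (x t) (x c)))

/-- The state prepared from `|0…0⟩` by a list of gates (first gate first). -/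
def prepare {W : Type} [Fintype W] [DecidableEq W] (L : List (Gate W)) : Ket W :=
  L.foldl (fun ψ g => g.apply ψ) (zeroKet W)

/-! ## Adversaries

An adversary is described by explicit circuits. The qubits of its working memory are arranged in
`r` registers of `n` qubits each and `a` ancilla qubits. -/

/-- The qubits of the working memory. -/
abbrev Wire (n r a : ℕ) : Type := (Fin r × Fin n) ⊕ Fin a

/-- The label of register `i` in the memory label `x`. -/
def readReg {n r a : ℕ} (x : Wire n r a → Bool) (i : Fin r) : Fin n → Bool :=
  fun q => x (Sum.inl (i, q))

/-- The memory label `x` with the label of register `i` replaced by `z`. -/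
def writeReg {n r a : ℕ} (x : Wire n r a → Bool) (i : Fin r) (z : Fin n → Bool) :
    Wire n r a → Bool
  | Sum.inl p => if p.1 = i then z p.2 else x (Sum.inl p)
  | Sum.inr j => x (Sum.inr j)

/-- Operations of the guess phase after `k` queries: elementary gates, the exchange of two
registers, and (ideal) controlled reflections of a register around the `s`-th queried state,
or around the response to it, the control being an ancilla. -/
inductive Instr (n k r a : ℕ) : Type
  | gate (g : Gate (Wire n r a))
  | swap (i j : Fin r)
  | reflIn (c : Fin a) (i : Fin r) (s : Fin k)
  | reflOut (c : Fin a) (i : Fin r) (s : Fin k)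

/-- The controlled reflection `|0⟩⟨0| ⊗ 1 + |1⟩⟨1| ⊗ (1 - 2|v⟩⟨v|)`, with control the ancilla
`c` and target the register `i`. -/
def ctrlReflect {n r a : ℕ} (v : Ket (Fin n)) (c : Fin a) (i : Fin r) (ψ : Ket (Wire n r a)) :
    Ket (Wire n r a) := fun x =>
  if x (Sum.inr c) then
    ψ x - 2 * v (readReg x i) * ∑ z : Fin n → Bool, star (v z) * ψ (writeReg x i z)
  else ψ x

/-- The action of an operation, given the queried states and the responses to them. -/
def Instr.apply {n k r a : ℕ} (qs rs : Fin k → Ket (Fin n)) :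
    Instr n k r a → Ket (Wire n r a) → Ket (Wire n r a)
  | .gate g, ψ => g.apply ψ
  | .swap i j, ψ => fun x => ψ (x ∘ Sum.map (Prod.map (Equiv.swap i j) id) id)
  | .reflIn c i s, ψ => ctrlReflect (qs s) c i ψ
  | .reflOut c i s, ψ => ctrlReflect (rs s) c i ψ

/-- The number of steps charged for an operation: one per elementary gate, `n` for the exchange
of two `n`-qubit registers, `n + 1` for a controlled reflection (of `n + 1` qubits). -/
def Instr.cost {n k r a : ℕ} : Instr n k r a → ℕ
  | .gate _ => 1
  | .swap _ _ => n
  | .reflIn _ _ _ => n + 1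
  | .reflOut _ _ _ => n + 1

/-- The initial content of a register: `|0…0⟩`, a fresh copy of a queried state or of the
challenge, or the response received for a query. -/
inductive Source (k : ℕ) : Type
  | blank
  | query (s : Fin k)
  | response (s : Fin k)
  | challenge

/-- An adversary against a device on `n` qubits in the existential game. In the learning phase it
sends the `k` pure states prepared by the circuits `query s` and stores the responses; in the
challenge phase it sends the state prepared by `challenge`; in the guess phase it runs `circuit`
on `r` registers, initialised as prescribed by `load`, and on `a` ancillas in the state `|0⟩`,
and outputs register `out`. Each response is a single quantum system, and is loaded into at most
one register. The device enters only through the responses to the queries. -/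
structure Adversary (n : ℕ) : Type where
  k : ℕ
  query : Fin k → List (Gate (Fin n))
  challenge : List (Gate (Fin n))
  r : ℕ
  a : ℕ
  load : Fin r → Source k
  load_once : ∀ i j s, load i = Source.response s → load j = Source.response s → i = j
  circuit : List (Instr n k r a)
  out : Fin r

namespace Adversary

variable {n : ℕ} (A : Adversary n)

/-- The `s`-th state queried in the learning phase. -/
def queryKet (s : Fin A.k) : Ket (Fin n) := prepare (A.query s)

/-- The challenge state. -/
def challengeKet : Ket (Fin n) := prepare A.challenge

/-- The response of the device `U` to the `s`-th query. -/
def responseKet (U : Unitary n) (s : Fin A.k) : Ket (Fin n) :=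
  (U : Matrix (Fin n → Bool) (Fin n → Bool) ℂ) *ᵥ A.queryKet s

/-- The state that a register is initialised with. -/
def sourceKet (U : Unitary n) : Source A.k → Ket (Fin n)
  | .blank => zeroKet (Fin n)
  | .query s => A.queryKet s
  | .response s => A.responseKet U s
  | .challenge => A.challengeKet

/-- The state of the memory at the start of the guess phase. -/
def initialKet (U : Unitary n) : Ket (Wire n A.r A.a) := fun x =>
  (∏ i, A.sourceKet U (A.load i) (readReg x i)) * zeroKet (Fin A.a) (fun j => x (Sum.inr j))

/-- The state of the memory at the end of the guess phase. -/
def finalKet (U : Unitary n) : Ket (Wire n A.r A.a) :=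
  A.circuit.foldl (fun ψ c => c.apply A.queryKet (A.responseKet U) ψ) (A.initialKet U)

/-- The guess: the reduced density matrix of the output register. -/
def guess (U : Unitary n) : Matrix (Fin n → Bool) (Fin n → Bool) ℂ := fun z z' =>
  ∑ x : Wire n A.r A.a → Bool, if readReg x A.out = z then
    A.finalKet U x * star (A.finalKet U (writeReg x A.out z')) else 0

/-- The fidelity of the guess and the correct response to the challenge. -/
def guessFidelity (U : Unitary n) : ℝ :=
  fidelity ((U : Matrix (Fin n → Bool) (Fin n → Bool) ℂ) *ᵥ A.challengeKet) (A.guess U)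

/-- The challenge is `μ`-distinguishable from every queried state. -/
def Distinguishable (μ : ℝ) : Prop :=
  ∀ s, fidelity A.challengeKet (density (A.queryKet s)) ≤ 1 - μ

/-- The number of steps of preparing the content of a register. -/
def loadCost : Source A.k → ℕ
  | .blank => n
  | .query s => n + (A.query s).length
  | .response _ => n
  | .challenge => n + A.challenge.length

/-- The number of steps of the adversary: preparation of the queries and of the challenge,
initialisation of the memory, and the guess circuit. (For several copies of the guess, the
adversary is run several times.) -/
def cost : ℕ :=
  (∑ s, (n + (A.query s).length)) + (n + A.challenge.length)
    + (∑ i, A.loadCost (A.load i)) + A.a + (A.circuit.map Instr.cost).sum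

end Adversary

/-- A quantum polynomial-time family of adversaries. -/
def IsQPT {n : ℕ → ℕ} (A : ∀ l, Adversary (n l)) : Prop :=
  PolyBounded fun l => (A l).cost

/-! ## Devices, tests and the game -/

/-- A family of devices with unitary evaluation on `n l` qubits: for each security parameter `l`,
a probability distribution `QGen l` of identifiers and, for each identifier, a unitary. -/
structure UqPUF (n : ℕ → ℕ) where
  Id : ℕ → Type
  measurableSpace : ∀ l, MeasurableSpace (Id l)
  QGen : ∀ l, Measure (Id l)
  isProbabilityMeasure : ∀ l, IsProbabilityMeasure (QGen l)
  eval : ∀ l, Id l → Unitary (n l)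
  measurable_eval : ∀ l i j,
    Measurable fun d => (eval l d : Matrix (Fin (n l) → Bool) (Fin (n l) → Bool) ℂ) i j

/-- A quantum testing algorithm, given by its probability `accept κ₁ κ₂ F` of accepting `κ₁`
copies of one state and `κ₂` copies of another one of fidelity `F` with it, and its error
`err κ₁ κ₂`. The limits in `F` are over the fidelities `F ∈ [0, 1]`, including the endpoint. -/
structure QuantumTest where
  accept : ℕ → ℕ → ℝ → ℝ
  err : ℕ → ℕ → ℝ
  measurable_accept : ∀ κ₁ κ₂, Measurable (accept κ₁ κ₂)
  accept_mem : ∀ κ₁ κ₂, ∀ F ∈ Set.Icc (0 : ℝ) 1, accept κ₁ κ₂ F ∈ Set.Icc (0 : ℝ) 1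
  tendsto_one : ∀ κ₁ κ₂, 1 ≤ κ₁ → 1 ≤ κ₂ →
    Tendsto (accept κ₁ κ₂) (𝓝[Set.Icc 0 1] 1) (𝓝 1)
  tendsto_fidelity : ∀ F ∈ Set.Icc (0 : ℝ) 1,
    Tendsto (fun κ : ℕ × ℕ => accept κ.1 κ.2 F) atTop (𝓝 F)
  tendsto_err : ∀ κ₁ κ₂, 1 ≤ κ₁ → 1 ≤ κ₂ →
    Tendsto (accept κ₁ κ₂) (𝓝[Set.Icc 0 1] 0) (𝓝 (err κ₁ κ₂))

open Classical in
/-- The probability that the adversary `A` wins the existential game with distinguishability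
parameter `μ` at security parameter `l`: a device is drawn from `QGen l`, and `κ₁` copies of the
correct response to the challenge are tested against `κ₂` copies of the guess. An adversary whose
challenge is not `μ`-distinguishable from all its queries loses. -/
def winProb {n : ℕ → ℕ} (P : UqPUF n) (T : QuantumTest) (l : ℕ) (μ : ℝ) (A : Adversary (n l))
    (κ₁ κ₂ : ℕ) : ℝ :=
  if A.Distinguishable μ then
    @integral (P.Id l) ℝ _ _ (P.measurableSpace l) (P.QGen l)
      fun d => T.accept κ₁ κ₂ (A.guessFidelity (P.eval l d))
  else 0

/-! ## The quantum emulation attack -/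

/-- The rotation with `|0⟩ ↦ cos θ |0⟩ + sin θ |1⟩`. -/
def rotation (θ : ℝ) : Matrix.unitaryGroup Bool ℂ :=
  ⟨Matrix.of fun i j => if i = j then (Real.cos θ : ℂ) else
      if i then (Real.sin θ : ℂ) else -(Real.sin θ : ℂ), by
    have h : (Real.cos θ : ℂ) * Real.cos θ + Real.sin θ * Real.sin θ = 1 := by
      rw [← sq, ← sq]; exact_mod_cast Real.cos_sq_add_sin_sq θ
    rw [Matrix.mem_unitaryGroup_iff]
    ext i j
    cases i <;> cases j <;>
      simp [Matrix.mul_apply, Matrix.star_apply, -Complex.ofReal_cos, -Complex.ofReal_sin] <;>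
      first | ring1 | linear_combination h⟩

/-- The NOT gate. -/
def pauliX : Matrix.unitaryGroup Bool ℂ :=
  ⟨Matrix.of fun i j => if i = j then 0 else 1, by
    rw [Matrix.mem_unitaryGroup_iff]
    ext i j
    cases i <;> cases j <;> simp [Matrix.mul_apply, Matrix.star_apply]⟩

/-- The Hadamard gate. -/
def hadamard : Matrix.unitaryGroup Bool ℂ :=
  ⟨Matrix.of fun i j => if i && j then -((√2)⁻¹ : ℝ) else ((√2)⁻¹ : ℝ), by
    have h : (((√2)⁻¹ : ℝ) : ℂ) * (((√2)⁻¹ : ℝ) : ℂ) = 1 / 2 := by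
      rw [← Complex.ofReal_mul, ← mul_inv, Real.mul_self_sqrt (by norm_num)]
      norm_num
    rw [Matrix.mem_unitaryGroup_iff]
    ext i j
    cases i <;> cases j <;>
      simp [Matrix.mul_apply, Matrix.star_apply, -Complex.ofReal_inv] <;>
      first | ring1 | linear_combination 2 * h⟩

/-- The quantum emulation algorithm with reference state number `ref` and one block for each of
the sample states `samples 0, samples 1, …`, each block using its own ancilla. Register `0`
initially holds the state to be transformed, and register `1` the response to the reference
state. The optional post-selection is left out. -/
def emulationCircuit {n k b : ℕ} (ref : Fin k) (samples : Fin b → Fin k) :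
    List (Instr n k 2 b) :=
  -- preparation of the ancillas in the state `(|0⟩ - |1⟩) / √2`
  (List.finRange b).flatMap (fun j =>
    [.gate (.single (.inr j) pauliX), .gate (.single (.inr j) hadamard)])
  -- the blocks, with reflections around the input states
  ++ (List.finRange b).flatMap (fun j =>
    [.reflIn j 0 ref, .gate (.single (.inr j) hadamard), .reflIn j 0 (samples j)])
  -- exchange with the response to the reference state
  ++ [.swap 0 1]
  -- the inverse blocks in reverse order, with reflections around the output states
  ++ (List.finRange b).reverse.flatMap (fun j =>
    [.reflOut j 0 (samples j), .gate (.single (.inr j) hadamard), .reflOut j 0 ref])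

/-- The weight of `φ₁` in `φ₂`: `1 / 2` if `μ ≤ 1 / 2`, and `μ` otherwise. -/
def weight (μ : ℝ) : ℝ := if μ ≤ 1 / 2 then 1 / 2 else μ

/-- The emulation attack. Query `0` is `φ₁ = |0…0⟩`, query `1` is
`φ₂ = √w φ₁ + √(1 - w) φ₃` with `w = weight μ`, and the challenge is `φ₃ = |10…0⟩`; the guess is
obtained by quantum emulation with reference state `φ₂` and sample state `φ₁`. -/
def emulationAdversary {n : ℕ} (hn : 0 < n) (μ : ℝ) : Adversary n where
  k := 2
  query := ![[], [.single ⟨0, hn⟩ (rotation (Real.arccos √(weight μ)))]]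
  challenge := [.single ⟨0, hn⟩ pauliX]
  r := 2
  a := 1
  load := ![.challenge, .response 1]
  load_once := by
    intro i j s
    fin_cases i <;> fin_cases j <;> simp
  circuit := emulationCircuit 1 ![0]
  out := 0

end QPUF

end

/-!
Both attacks query `φ₁ = |0…0⟩` and a superposition `φ₂ = cos θ φ₁ + sin θ φ₃` with the challenge
`φ₃ = |10…0⟩`, so that the challenge has overlap `0` and `sin² θ` with the queries. Everything that
the device `U` contributes happens in the plane spanned by `U φ₁` and `U φ₃`, and a unitary
preserves inner products. Hence the fidelity of the guess is a number that does not depend on the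
device, and the winning probability is the acceptance probability of the test at this number
(`winProb_eq`).

*First claim.* The limits that define a test say nothing uniform about its acceptance probability
at a fidelity below `1`, so the guess has to be exact. The pair of reflections around the responses
`U φ₁` and `U φ₂` rotates their plane by `2 θ`; starting from the response `U φ₂`, at angle `θ`,
`m` rounds lead to the angle `(2 m + 1) θ` (`amplification_guessFidelity`). For
`θ = π / (2 (2 m + 1))` this is exactly `U φ₃`. Since `sin² θ ≤ 1 / m`, the challenge is
distinguishable as soon as `1 / m ≤ 1 - μ`. If `1 - μ` is not negligible, this holds for a suitable
power `m` of the security parameter infinitely often, and there the attack wins with certainty.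
At the remaining parameters the angle is set to `0`, which keeps the challenge distinguishable.

*Second claim.* With reference weight `w = cos² θ`, following the amplitudes through the emulation
circuit (`emulation_foldl`) gives the fidelity `(1 - w) (1 + 4 w²)` for the guess. It equals `1` at
`w = 1 / 2`; the stated bound for `w = μ > 1 / 2` follows as `μ ≥ 1 - μ`. As the fidelity is a
function of `μ` alone, and at least `1 - μ`, the pointwise convergence of the test to the fidelity
provides, for each value of `μ`, a threshold beyond which the winning probability is at least
`(1 - μ) / 2`.
-/

noncomputable section

namespace QPUF

/-! ### Orthonormal pairs and reflections -/

section Plane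

variable {ι : Type}

/-- The vector `p f + q g`. -/
def comb (f g : ι → ℂ) (p q : ℂ) : ι → ℂ := p • f + q • g

theorem comb_smul (f g : ι → ℂ) (t p q : ℂ) :
    t • comb f g p q = comb f g (t * p) (t * q) := by
  simp [comb, smul_smul]

theorem comb_add (f g : ι → ℂ) (p q p' q' : ℂ) :
    comb f g p q + comb f g p' q' = comb f g (p + p') (q + q') := by
  simp only [comb, add_smul]; abel

variable [Fintype ι]

/-- `f` and `g` are orthonormal for the Hermitian form `star u ⬝ᵥ v`. -/
structure OrthoPair (f g : ι → ℂ) : Prop where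
  norm_left : star f ⬝ᵥ f = 1
  norm_right : star g ⬝ᵥ g = 1
  orthogonal : star f ⬝ᵥ g = 0

/-- The reflection `1 - 2|v⟩⟨v|`. -/
def reflect (v u : ι → ℂ) : ι → ℂ := u - (2 * (star v ⬝ᵥ u)) • v

theorem OrthoPair.orthogonal' {f g : ι → ℂ} (h : OrthoPair f g) : star g ⬝ᵥ f = 0 := by
  have := congrArg star h.orthogonal
  rwa [← Matrix.star_dotProduct_star, star_star, star_zero] at this

theorem OrthoPair.map_unitary [DecidableEq ι] {f g : ι → ℂ} (h : OrthoPair f g)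
    (U : Matrix.unitaryGroup ι ℂ) :
    OrthoPair ((U : Matrix ι ι ℂ) *ᵥ f) ((U : Matrix ι ι ℂ) *ᵥ g) := by
  have key (u v : ι → ℂ) :
      star ((U : Matrix ι ι ℂ) *ᵥ u) ⬝ᵥ ((U : Matrix ι ι ℂ) *ᵥ v) = star u ⬝ᵥ v := by
    rw [Matrix.star_mulVec, Matrix.dotProduct_mulVec, Matrix.vecMul_vecMul,
      ← Matrix.star_eq_conjTranspose, Matrix.UnitaryGroup.star_mul_self, Matrix.vecMul_one]
  exact ⟨(key _ _).trans h.1, (key _ _).trans h.2, (key _ _).trans h.3⟩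

theorem mulVec_comb (M : Matrix ι ι ℂ) (f g : ι → ℂ) (p q : ℂ) :
    M *ᵥ comb f g p q = comb (M *ᵥ f) (M *ᵥ g) p q := by
  simp [comb, Matrix.mulVec_add, Matrix.mulVec_smul]

variable {f g : ι → ℂ}

theorem OrthoPair.dotProduct_comb (h : OrthoPair f g) (c d p q : ℂ) :
    star (comb f g c d) ⬝ᵥ comb f g p q = star c * p + star d * q := by
  simp only [comb, star_add, star_smul, add_dotProduct, dotProduct_add, smul_dotProduct,
    dotProduct_smul, h.norm_left, h.norm_right, h.orthogonal, h.orthogonal', smul_eq_mul]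
  ring

theorem OrthoPair.right_dotProduct_comb (h : OrthoPair f g) (p q : ℂ) :
    star g ⬝ᵥ comb f g p q = q := by
  simpa [comb] using h.dotProduct_comb 0 1 p q

theorem OrthoPair.reflect_comb (h : OrthoPair f g) (c d : ℝ) (p q : ℂ) :
    reflect (comb f g c d) (comb f g p q) =
      comb f g (p - 2 * (c * p + d * q) * c) (q - 2 * (c * p + d * q) * d) := by
  rw [reflect, h.dotProduct_comb]
  ext i
  simp [comb]
  ring

theorem OrthoPair.reflect_left_comb (h : OrthoPair f g) (p q : ℂ) :
    reflect f (comb f g p q) = comb f g (-p) q := by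
  have := h.reflect_comb 1 0 p q
  have e : comb f g (1 : ℝ) (0 : ℝ) = f := by simp [comb]
  rw [e] at this
  rw [this]
  congr 1 <;> simp
  ring

theorem OrthoPair.sum_normSq_comb (h : OrthoPair f g) (p q : ℝ) :
    ∑ i, Complex.normSq (comb f g p q i) = p ^ 2 + q ^ 2 := by
  have e := h.dotProduct_comb p q p q
  have : star (comb f g p q) ⬝ᵥ comb f g p q
      = ((∑ i, Complex.normSq (comb f g p q i) : ℝ) : ℂ) := by
    simp [dotProduct, Complex.normSq_eq_conj_mul_self]
  rw [this] at e
  have e' : ((∑ i, Complex.normSq (comb f g p q i) : ℝ) : ℂ) = ((p ^ 2 + q ^ 2 : ℝ) : ℂ) := by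
    rw [e]; simp; ring
  exact_mod_cast e'

end Plane

/-! ### Memory of two registers and one ancilla -/

section Memory

variable {n k : ℕ}

/-- The state of two registers and one ancilla that is given by its partial amplitudes: `Ψ y b`
is the (unnormalised) state of register `0` when register `1` has label `y` and the ancilla has
label `b`. -/
def memState (Ψ : (Fin n → Bool) → Bool → Ket (Fin n)) : Ket (Wire n 2 1) :=
  fun x => Ψ (readReg x 1) (x (Sum.inr 0)) (readReg x 0)

/-- The labels of the memory are triples of labels of the two registers and of the ancilla. -/
def wireEquiv (n : ℕ) :
    (Wire n 2 1 → Bool) ≃ ((Fin n → Bool) × Bool) × (Fin n → Bool) where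
  toFun x := ((readReg x 1, x (Sum.inr 0)), readReg x 0)
  invFun p
    | Sum.inl (i, q) => if i = 0 then p.2 q else p.1.1 q
    | Sum.inr _ => p.1.2
  left_inv x := by
    ext w
    rcases w with ⟨i, q⟩ | j
    · fin_cases i <;> simp [readReg]
    · simp [Subsingleton.elim j 0]
  right_inv p := by
    ext <;> simp [readReg]

theorem memState_writeReg (Ψ : (Fin n → Bool) → Bool → Ket (Fin n)) (x : Wire n 2 1 → Bool)
    (z : Fin n → Bool) :
    memState Ψ (writeReg x 0 z) = Ψ (readReg x 1) (x (Sum.inr 0)) z := by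
  have h0 : readReg (writeReg x 0 z) 0 = z := by funext q; simp [readReg, writeReg]
  have h1 : readReg (writeReg x 0 z) 1 = readReg x 1 := by funext q; simp [readReg, writeReg]
  simp [memState, writeReg, h0, h1]

theorem readReg_update_ancilla {r a : ℕ} (x : Wire n r a → Bool) (i : Fin r) (j : Fin a)
    (b : Bool) : readReg (Function.update x (Sum.inr j) b) i = readReg x i := by
  ext q
  simp [readReg]

/-- The reduced density matrix of register `0`. -/
theorem reduced_memState (Ψ : (Fin n → Bool) → Bool → Ket (Fin n)) :
    (fun z z' => ∑ x : Wire n 2 1 → Bool, if readReg x 0 = z then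
      memState Ψ x * star (memState Ψ (writeReg x 0 z')) else 0) =
    ∑ y, ∑ b, density (Ψ y b) := by
  funext z z'
  simp only [memState_writeReg]
  refine (Fintype.sum_equiv (wireEquiv n) _
    (fun p => if p.2 = z then Ψ p.1.1 p.1.2 p.2 * star (Ψ p.1.1 p.1.2 z') else 0)
    (fun x => rfl)).trans ?_
  rw [Fintype.sum_prod_type, Fintype.sum_prod_type]
  simp only [Finset.sum_ite_eq', Finset.mem_univ, if_true]
  refine Eq.trans ?_ (Matrix.sum_apply z z' _ _).symm
  simp only [Matrix.sum_apply, density, Matrix.vecMulVec_apply, Pi.star_apply]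

theorem fidelity_density {ι : Type} [Fintype ι] (ψ φ : ι → ℂ) :
    fidelity ψ (density φ) = Complex.normSq (star ψ ⬝ᵥ φ) := by
  have : star φ ⬝ᵥ ψ = star (star ψ ⬝ᵥ φ) := by
    rw [Matrix.star_dotProduct]
  rw [fidelity, density, Matrix.vecMulVec_mulVec, this, op_smul_eq_smul, dotProduct_smul,
    smul_eq_mul, mul_comm]
  simp [Complex.mul_conj]

theorem fidelity_sum {ι κ : Type} [Fintype ι] (s : Finset κ) (ψ : ι → ℂ)
    (ρ : κ → Matrix ι ι ℂ) : fidelity ψ (∑ i ∈ s, ρ i) = ∑ i ∈ s, fidelity ψ (ρ i) := by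
  simp [fidelity, Matrix.sum_mulVec, dotProduct_sum]

/-- The fidelity of register `0` with `g'`, if all its partial states lie in the plane of `f'` and
`g'`: only the `g'` components count. -/
theorem fidelity_memState {f' g' : Ket (Fin n)} (h' : OrthoPair f' g')
    {P Q : (Fin n → Bool) → Bool → ℂ} {ψ : Ket (Wire n 2 1)}
    (hψ : ψ = memState fun y b => comb f' g' (P y b) (Q y b)) :
    fidelity g' (fun z z' => ∑ x : Wire n 2 1 → Bool, if readReg x 0 = z then
      ψ x * star (ψ (writeReg x 0 z')) else 0) = ∑ y, ∑ b, Complex.normSq (Q y b) := by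
  subst hψ
  rw [reduced_memState]
  simp only [fidelity_sum, fidelity_density, h'.right_dotProduct_comb]

theorem zeroKet_ancilla (x : Wire n 2 1 → Bool) :
    zeroKet (Fin 1) (fun j => x (Sum.inr j)) = if x (Sum.inr 0) then 0 else 1 := by
  rcases hx : x (Sum.inr 0) with _ | _
  · have : (fun j : Fin 1 => x (Sum.inr j)) = fun _ => false := by
      funext j; rw [Subsingleton.elim j 0, hx]
    simp [zeroKet, basisKet, this]
  · have : (fun j : Fin 1 => x (Sum.inr j)) ≠ fun _ => false := by
      intro h
      simpa [hx] using congrFun h 0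
    simp [zeroKet, basisKet, this]

/-- The initial state of the memory: the two registers are loaded with `u` and `v`, and the ancilla
is in the state `|0⟩`. -/
theorem memState_initial (u v : Ket (Fin n)) :
    (fun x : Wire n 2 1 → Bool => u (readReg x 0) * v (readReg x 1) *
      zeroKet (Fin 1) (fun j => x (Sum.inr j))) =
    memState fun y b => if b then 0 else v y • u := by
  funext x
  rw [zeroKet_ancilla]
  rcases hx : x (Sum.inr 0) with _ | _
  · simp [memState, hx, mul_comm]
  · simp [memState, hx]

theorem memState_single (qs rs : Fin k → Ket (Fin n)) (g : Matrix.unitaryGroup Bool ℂ)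
    (Ψ : (Fin n → Bool) → Bool → Ket (Fin n)) :
    (Instr.gate (.single (Sum.inr 0) g) : Instr n k 2 1).apply qs rs (memState Ψ) =
      memState fun y b => (g : Matrix Bool Bool ℂ) b true • Ψ y true
        + (g : Matrix Bool Bool ℂ) b false • Ψ y false := by
  funext x
  simp [Instr.apply, Gate.apply, memState, readReg_update_ancilla]

theorem ctrlReflect_memState (v : Ket (Fin n)) (Ψ : (Fin n → Bool) → Bool → Ket (Fin n)) :
    ctrlReflect v 0 0 (memState Ψ) =
      memState fun y b => if b then reflect v (Ψ y b) else Ψ y b := by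
  funext x
  simp only [ctrlReflect, memState_writeReg]
  rcases hx : x (Sum.inr 0) with _ | _
  · simp [memState, hx]
  · simp [memState, hx, reflect, dotProduct]
    ring

theorem memState_reflIn (qs rs : Fin k → Ket (Fin n)) (s : Fin k)
    (Ψ : (Fin n → Bool) → Bool → Ket (Fin n)) :
    (Instr.reflIn 0 0 s : Instr n k 2 1).apply qs rs (memState Ψ) =
      memState fun y b => if b then reflect (qs s) (Ψ y b) else Ψ y b :=
  ctrlReflect_memState _ _

theorem memState_reflOut (qs rs : Fin k → Ket (Fin n)) (s : Fin k)
    (Ψ : (Fin n → Bool) → Bool → Ket (Fin n)) :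
    (Instr.reflOut 0 0 s : Instr n k 2 1).apply qs rs (memState Ψ) =
      memState fun y b => if b then reflect (rs s) (Ψ y b) else Ψ y b :=
  ctrlReflect_memState _ _

theorem memState_swap (qs rs : Fin k → Ket (Fin n))
    (Ψ : (Fin n → Bool) → Bool → Ket (Fin n)) :
    (Instr.swap 0 1 : Instr n k 2 1).apply qs rs (memState Ψ) =
      memState fun y b z => Ψ z b y := by
  funext x
  have h0 : readReg (x ∘ Sum.map (Prod.map (Equiv.swap (0 : Fin 2) 1) id) id) 0 = readReg x 1 := by
    funext q; simp [readReg]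
  have h1 : readReg (x ∘ Sum.map (Prod.map (Equiv.swap (0 : Fin 2) 1) id) id) 1 = readReg x 0 := by
    funext q; simp [readReg]
  simp only [Instr.apply, memState, h0, h1]
  rfl

theorem pauliX_apply (i j : Bool) :
    (pauliX : Matrix Bool Bool ℂ) i j = if i = j then 0 else 1 := rfl

theorem hadamard_apply (i j : Bool) : (hadamard : Matrix Bool Bool ℂ) i j =
    if i && j then -(((√2)⁻¹ : ℝ) : ℂ) else (((√2)⁻¹ : ℝ) : ℂ) := rfl

theorem rotation_apply (θ : ℝ) (i j : Bool) : (rotation θ : Matrix Bool Bool ℂ) i j =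
    if i = j then (Real.cos θ : ℂ) else
      if i then (Real.sin θ : ℂ) else -(Real.sin θ : ℂ) := rfl

end Memory

/-! ### The prepared states -/

section Prepare

variable {n : ℕ} (hn : 0 < n)

/-- The basis state `|10…0⟩`. -/
def oneKet : Ket (Fin n) := basisKet (Function.update (fun _ => false) ⟨0, hn⟩ true)

theorem orthoPair_zero_one : OrthoPair (zeroKet (Fin n)) (oneKet hn) := by
  have hne : (fun _ => false : Fin n → Bool) ≠ Function.update (fun _ => false) ⟨0, hn⟩ true := by
    intro h
    simpa using congrFun h ⟨0, hn⟩
  refine ⟨?_, ?_, ?_⟩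
  · simp [zeroKet, basisKet, dotProduct_single]
  · simp [oneKet, basisKet, dotProduct_single]
  · simp [oneKet, zeroKet, basisKet, dotProduct_single, hne.symm]

/-- A one-qubit gate maps `|0…0⟩` into the plane of `|0…0⟩` and `|10…0⟩`. -/
theorem prepare_single (g : Matrix.unitaryGroup Bool ℂ) :
    prepare [Gate.single ⟨0, hn⟩ g] = comb (zeroKet (Fin n)) (oneKet hn)
      ((g : Matrix Bool Bool ℂ) false false) ((g : Matrix Bool Bool ℂ) true false) := by
  funext x
  have e1 : Function.update x ⟨0, hn⟩ true ≠ fun _ => false := by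
    intro h
    simpa using congrFun h ⟨0, hn⟩
  have e2 : (Function.update x ⟨0, hn⟩ false = fun _ => false) ↔
      x = (fun _ => false) ∨ x = Function.update (fun _ => false) ⟨0, hn⟩ true := by
    constructor
    · intro h
      rcases hx : x ⟨0, hn⟩ with _ | _
      · left
        rw [← h, ← hx, Function.update_eq_self]
      · right
        rw [← h, Function.update_idem, ← hx, Function.update_eq_self]
    · rintro (rfl | rfl) <;> simp
  have e3 : (fun _ => false : Fin n → Bool) ≠ Function.update (fun _ => false) ⟨0, hn⟩ true := by
    intro h
    simpa using congrFun h ⟨0, hn⟩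
  simp only [prepare, List.foldl, Gate.apply, zeroKet, basisKet, Pi.single_apply,
    Fintype.sum_bool, e1, e2, comb, oneKet, Pi.add_apply, Pi.smul_apply]
  by_cases h1 : x = fun _ => false
  · subst h1
    simp [e3]
  · by_cases h2 : x = Function.update (fun _ => false) ⟨0, hn⟩ true
    · subst h2
      simp [e3.symm]
    · simp [h1, h2]

theorem prepare_pauliX : prepare [Gate.single ⟨0, hn⟩ pauliX] = oneKet hn := by
  simp [prepare_single, pauliX_apply, comb]

theorem prepare_rotation (θ : ℝ) : prepare [Gate.single ⟨0, hn⟩ (rotation θ)] =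
    comb (zeroKet (Fin n)) (oneKet hn) (Real.cos θ : ℝ) (Real.sin θ : ℝ) := by
  rw [prepare_single, rotation_apply, rotation_apply]
  simp

end Prepare

/-! ### The emulation attack -/

section Emulation

variable {n : ℕ} (hn : 0 < n)

/-- The fidelity of the guess of the emulation attack when the reference state has weight `w` on
the sample state. It does not depend on the device. -/
def emulationFidelity (w : ℝ) : ℝ := (1 - w) * (1 + 4 * w ^ 2)

theorem inv_sqrt_two_mul_self : (√2)⁻¹ * (√2)⁻¹ = (1 : ℝ) / 2 := by
  rw [← mul_inv, Real.mul_self_sqrt (by norm_num), one_div]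

theorem emulationCircuit_one {k : ℕ} (ref s : Fin k) :
    (emulationCircuit ref ![s] : List (Instr n k 2 1)) =
    [.gate (.single (.inr 0) pauliX), .gate (.single (.inr 0) hadamard),
      .reflIn 0 0 ref, .gate (.single (.inr 0) hadamard), .reflIn 0 0 s, .swap 0 1,
      .reflOut 0 0 s, .gate (.single (.inr 0) hadamard), .reflOut 0 0 ref] := by
  simp [emulationCircuit, List.finRange_succ]

/-- The final memory state of the emulation, in the plane of `φ₁, φ₃` (`f, g`) and in that of
their images (`f', g'`), with reference state `c φ₁ + s φ₃` and sample state `φ₁`. The fidelity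
of the guess with the image of `φ₃` depends on the `g'` components only. -/
theorem emulation_foldl {k : ℕ} {f g f' g' : Ket (Fin n)} (h : OrthoPair f g)
    (h' : OrthoPair f' g') {c s : ℝ} (hcs : c ^ 2 + s ^ 2 = 1) (qs rs : Fin k → Ket (Fin n))
    (ref smp : Fin k) (hq : qs ref = comb f g c s) (hq' : qs smp = f)
    (hr : rs ref = comb f' g' c s) (hr' : rs smp = f') :
    ∃ P : (Fin n → Bool) → Bool → ℂ,
    (emulationCircuit ref ![smp] : List (Instr n k 2 1)).foldl (fun ψ c => c.apply qs rs ψ)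
      (memState fun y b => if b then 0 else comb f' g' c s y • comb f g 0 1) =
    memState fun y b => comb f' g' (P y b)
      (if b then
        -((√2)⁻¹ : ℝ) * s * comb f g (c * s + c * s * (4 * c ^ 2 - 1) : ℝ)
            (s ^ 2 + c ^ 2 * (4 * c ^ 2 - 1) : ℝ) y
      else ((√2)⁻¹ : ℝ) * s * comb f g (2 * c * s : ℝ) (1 : ℝ) y) := by
  have h2 : (((√2)⁻¹ : ℝ) : ℂ) * (((√2)⁻¹ : ℝ) : ℂ) = 1 / 2 := by
    rw [← Complex.ofReal_mul, inv_sqrt_two_mul_self]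
    norm_num
  have hcs' : (c : ℂ) ^ 2 + (s : ℂ) ^ 2 = 1 := by exact_mod_cast hcs
  generalize ht : (((√2)⁻¹ : ℝ) : ℂ) = t at h2 ⊢
  -- the ancilla is prepared in the state `(|0⟩ - |1⟩) / √2`
  have e1 : (Instr.gate (.single (.inr 0) hadamard) : Instr n k 2 1).apply qs rs
      ((Instr.gate (.single (.inr 0) pauliX) : Instr n k 2 1).apply qs rs
        (memState fun y b => if b then 0 else comb f' g' c s y • comb f g 0 1)) =
      memState fun y b => comb f g 0
        (if b then -t * comb f' g' c s y else t * comb f' g' c s y) := by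
    rw [memState_single, memState_single]
    congr 1
    funext y b
    simp only [pauliX_apply, hadamard_apply, ht]
    ext z
    cases b <;> simp [comb] <;> ring
  -- the block maps `φ₃` to `s |0⟩ φ₂ + c |1⟩ (s φ₁ + c φ₃)`, which has `φ₂` as a factor if `c = s`
  have e2 : (Instr.reflIn 0 0 smp : Instr n k 2 1).apply qs rs
      ((Instr.gate (.single (.inr 0) hadamard) : Instr n k 2 1).apply qs rs
        ((Instr.reflIn 0 0 ref : Instr n k 2 1).apply qs rs
        (memState fun y b => comb f g 0
          (if b then -t * comb f' g' c s y else t * comb f' g' c s y)))) =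
      memState fun y b => comb f' g' c s y •
        if b then comb f g (c * s) (c * c) else comb f g (s * c) (s * s) := by
    rw [memState_reflIn, memState_single, memState_reflIn]
    congr 1
    funext y b
    simp only [hq, hq', if_true, h.reflect_comb, hadamard_apply, ht, comb_smul]
    cases b
    · simp only [Bool.false_eq_true, if_false, Bool.and_false, Bool.and_true, comb_smul, comb_add]
      congr 1
      · linear_combination (2 * s * c * comb f' g' c s y) * h2
      · linear_combination (2 * s * s * comb f' g' c s y) * h2
    · simp only [if_true, Bool.false_eq_true, if_false, Bool.and_false, Bool.and_true, comb_smul,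
        comb_add, h.reflect_left_comb]
      congr 1
      · linear_combination (2 * s * c * comb f' g' c s y) * h2
      · linear_combination (2 * (1 - s * s) * comb f' g' c s y) * h2 -
          comb f' g' c s y * hcs'
  -- after the exchange the output register holds the response to the reference state
  have e3 : (Instr.swap 0 1 : Instr n k 2 1).apply qs rs
      (memState fun y b => comb f' g' c s y •
        if b then comb f g (c * s) (c * c) else comb f g (s * c) (s * s)) =
      memState fun y b => if b then (c * comb f g s c y) • comb f' g' c s
        else (s * comb f g c s y) • comb f' g' c s := by
    rw [memState_swap]
    congr 1
    funext y b z
    cases b <;> simp [comb] <;> ring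
  rw [emulationCircuit_one]
  simp only [List.foldl_cons, List.foldl_nil]
  rw [e1, e2, e3, memState_reflOut, memState_single, memState_reflOut]
  -- the `f'` components, read off from the inverse block
  refine ⟨fun y b => if b then
      t * (s * comb f g c s y * c + c * comb f g s c y * c) - 2 *
        (c * (t * (s * comb f g c s y * c + c * comb f g s c y * c)) +
          s * (t * (s * comb f g c s y * s - c * comb f g s c y * s))) * c
    else t * (s * comb f g c s y * c - c * comb f g s c y * c),
    congrArg memState (funext fun y => funext fun b => ?_)⟩
  simp only [hr, hr', hadamard_apply, ht]
  cases b
  · simp only [Bool.false_eq_true, if_false, if_true, Bool.and_true, Bool.false_and,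
      h'.reflect_left_comb, comb_smul, comb_add]
    congr 1
    · ring
    · simp only [comb, Pi.add_apply, Pi.smul_apply, smul_eq_mul]
      push_cast
      linear_combination (t * s * g y) * hcs'
  · simp only [Bool.false_eq_true, if_false, if_true, Bool.and_false, Bool.and_true,
      h'.reflect_left_comb, comb_smul, comb_add, h'.reflect_comb]
    congr 1
    · ring
    · simp only [comb, Pi.add_apply, Pi.smul_apply, smul_eq_mul]
      push_cast
      linear_combination (-2 * t * s * (s * (c * f y + s * g y))
        + 2 * t * s * (c * (s * f y + c * g y))) * hcs'

/-- The fidelity of the emulated state with the image of `φ₃`. By `emulation_foldl` it is a sum of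
two squared norms of vectors in the plane of `φ₁` and `φ₃`, one for each label of the ancilla. -/
theorem fidelity_emulationCircuit {k : ℕ} {f g f' g' : Ket (Fin n)} (h : OrthoPair f g)
    (h' : OrthoPair f' g') {c s : ℝ} (hcs : c ^ 2 + s ^ 2 = 1) (qs rs : Fin k → Ket (Fin n))
    (ref smp : Fin k) (hq : qs ref = comb f g c s) (hq' : qs smp = f)
    (hr : rs ref = comb f' g' c s) (hr' : rs smp = f') {ψ : Ket (Wire n 2 1)}
    (hψ : ψ = (emulationCircuit ref ![smp] : List (Instr n k 2 1)).foldl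
      (fun ψ c => c.apply qs rs ψ)
      (memState fun y b => if b then 0 else comb f' g' c s y • comb f g 0 1)) :
    fidelity g' (fun z z' => ∑ x : Wire n 2 1 → Bool, if readReg x 0 = z then
      ψ x * star (ψ (writeReg x 0 z')) else 0) = emulationFidelity (c ^ 2) := by
  obtain ⟨P, hP⟩ := emulation_foldl h h' hcs qs rs ref smp hq hq' hr hr'
  rw [fidelity_memState h' (hψ.trans hP)]
  simp only [Fintype.sum_bool, if_true, Bool.false_eq_true, if_false, map_mul, Complex.normSq_neg,
    Complex.normSq_ofReal, inv_sqrt_two_mul_self, Finset.sum_add_distrib, ← Finset.mul_sum,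
    h.sum_normSq_comb, emulationFidelity]
  have hs : s ^ 2 = 1 - c ^ 2 := by linarith
  have e : s * s * ((2 * c * s) ^ 2 + 1 ^ 2 + ((c * s + c * s * (4 * c ^ 2 - 1)) ^ 2 +
      (s ^ 2 + c ^ 2 * (4 * c ^ 2 - 1)) ^ 2)) / 2 = (1 - c ^ 2) * (1 + 4 * (c ^ 2) ^ 2) := by
    calc _ = s ^ 2 / 2 * (4 * c ^ 2 * s ^ 2 + 1 + (16 * (c ^ 2) ^ 3 * s ^ 2
          + (s ^ 2 + c ^ 2 * (4 * c ^ 2 - 1)) ^ 2)) := by ring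
      _ = _ := by rw [hs]; ring
  linarith

theorem emulation_initialKet (μ : ℝ) (U : Unitary n) :
    (emulationAdversary hn μ).initialKet U = memState fun y b => if b then 0 else
      (emulationAdversary hn μ).responseKet U (1 : Fin 2) y •
        (emulationAdversary hn μ).challengeKet := by
  refine Eq.trans (funext fun x => ?_) (memState_initial _ _)
  exact congrArg (· * _) (Fin.prod_univ_two _)

theorem emulation_queryKet_zero (μ : ℝ) :
    (emulationAdversary hn μ).queryKet (0 : Fin 2) = zeroKet (Fin n) := rfl

theorem emulation_challengeKet (μ : ℝ) :
    (emulationAdversary hn μ).challengeKet = oneKet hn := prepare_pauliX hn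

theorem weight_mem {μ : ℝ} (h1 : μ ≤ 1) : 0 ≤ weight μ ∧ weight μ ≤ 1 := by
  unfold weight
  split_ifs <;> constructor <;> linarith

theorem emulation_queryKet_one {μ : ℝ} (h1 : μ ≤ 1) :
    (emulationAdversary hn μ).queryKet (1 : Fin 2) = comb (zeroKet (Fin n)) (oneKet hn)
      (√(weight μ) : ℝ) (√(1 - weight μ) : ℝ) := by
  obtain ⟨hw0, hw1⟩ := weight_mem h1
  refine (prepare_rotation hn _).trans ?_
  rw [Real.sin_arccos, Real.sq_sqrt hw0, Real.cos_arccos]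
  · linarith [Real.sqrt_nonneg (weight μ)]
  · exact Real.sqrt_le_one.2 hw1

/-- The fidelity is the same for every device, because all vectors stay in the image of the plane
of `φ₁` and `φ₃`, whose geometry `U` preserves. -/
theorem emulation_guessFidelity {μ : ℝ} (h1 : μ ≤ 1) (U : Unitary n) :
    (emulationAdversary hn μ).guessFidelity U =
      emulationFidelity (weight μ) := by
  obtain ⟨hw0, hw1⟩ := weight_mem h1
  have h := orthoPair_zero_one hn
  have h' := h.map_unitary U
  have hcs : √(weight μ) ^ 2 + √(1 - weight μ) ^ 2 = 1 := by
    rw [Real.sq_sqrt hw0, Real.sq_sqrt (by linarith)]; ring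
  have hr : (emulationAdversary hn μ).responseKet U (1 : Fin 2) = _ :=
    (congrArg _ (emulation_queryKet_one hn h1)).trans (mulVec_comb _ _ _ _ _)
  have hone : comb (zeroKet (Fin n)) (oneKet hn) 0 1 = oneKet hn := by simp [comb]
  have hinit := emulation_initialKet hn μ U
  rw [hr, emulation_challengeKet] at hinit
  have hfin : (emulationAdversary hn μ).finalKet U =
      (emulationCircuit (1 : Fin 2) ![0] : List (Instr n 2 2 1)).foldl (fun ψ c => c.apply
        (emulationAdversary hn μ).queryKet ((emulationAdversary hn μ).responseKet U) ψ) _ :=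
    congrArg (List.foldl _ · _) hinit
  have hfid := fidelity_emulationCircuit h h' hcs _ _ (1 : Fin 2) (0 : Fin 2)
    (emulation_queryKet_one hn h1) (emulation_queryKet_zero hn μ) hr rfl
    (ψ := (emulationAdversary hn μ).finalKet U) (by rw [hone]; exact hfin)
  unfold Adversary.guessFidelity
  rw [emulation_challengeKet]
  rwa [Real.sq_sqrt hw0] at hfid

end Emulation

theorem emulationFidelity_of_le {μ : ℝ} (h : μ ≤ 1 / 2) : emulationFidelity (weight μ) = 1 := by
  rw [weight, if_pos h, emulationFidelity]
  norm_num

theorem le_emulationFidelity {μ : ℝ} (h : 1 / 2 < μ) (h1 : μ ≤ 1) :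
    (1 - μ) * (1 + 4 * μ * (1 - μ)) ≤ emulationFidelity (weight μ) := by
  rw [weight, if_neg h.not_ge, emulationFidelity]
  refine mul_le_mul_of_nonneg_left ?_ (by linarith)
  nlinarith

theorem emulationFidelity_le_one {w : ℝ} (h0 : 0 ≤ w) : emulationFidelity w ≤ 1 := by
  have : 1 - emulationFidelity w = w * (1 - 2 * w) ^ 2 := by unfold emulationFidelity; ring
  have : 0 ≤ w * (1 - 2 * w) ^ 2 := by positivity
  linarith

theorem one_sub_le_emulationFidelity {μ : ℝ} (h0 : 0 ≤ μ) (h1 : μ ≤ 1) :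
    1 - μ ≤ emulationFidelity (weight μ) := by
  rcases le_or_gt μ (1 / 2) with h | h
  · rw [emulationFidelity_of_le h]; linarith
  · rw [weight, if_neg h.not_ge, emulationFidelity]
    exact le_mul_of_one_le_right (by linarith) (by linarith [sq_nonneg μ])

theorem emulationFidelity_weight_mem {μ : ℝ} (h0 : 0 ≤ μ) (h1 : μ ≤ 1) :
    emulationFidelity (weight μ) ∈ Set.Icc (0 : ℝ) 1 :=
  ⟨(sub_nonneg.2 h1).trans (one_sub_le_emulationFidelity h0 h1),
    emulationFidelity_le_one (weight_mem h1).1⟩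

theorem emulation_distinguishable {n : ℕ} (hn : 0 < n) {μ : ℝ} (h1 : μ ≤ 1) :
    (emulationAdversary hn μ).Distinguishable μ := by
  obtain ⟨hw0, hw1⟩ := weight_mem h1
  have h := orthoPair_zero_one hn
  have key : ∀ s : Fin 2, fidelity (emulationAdversary hn μ).challengeKet
      (density ((emulationAdversary hn μ).queryKet s)) ≤ 1 - μ := by
    intro s
    rw [fidelity_density, emulation_challengeKet]
    fin_cases s
    · change Complex.normSq (star (oneKet hn) ⬝ᵥ zeroKet (Fin n)) ≤ _
      rw [h.orthogonal', map_zero]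
      linarith
    · have e : (emulationAdversary hn μ).queryKet (1 : Fin 2) = _ := emulation_queryKet_one hn h1
      refine (congrArg (fun v => Complex.normSq (star (oneKet hn) ⬝ᵥ v)) e).trans_le ?_
      simp only [h.right_dotProduct_comb, Complex.normSq_ofReal]
      rw [Real.mul_self_sqrt (by linarith), weight]
      split_ifs with hm <;> linarith
  exact key

/-! ### Exact amplitude amplification -/

/-- The adversary by exact amplitude amplification. Query `0` is `φ₁ = |0…0⟩`, query `1` is
`cos θ φ₁ + sin θ φ₃`, and the challenge is `φ₃ = |10…0⟩`. Starting from the response to query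
`1`, it applies `m` times the reflections around the two responses, each pair of which is a
rotation by `2 θ` in their plane. The reflections are controlled by an ancilla in the state `|1⟩`;
register `1` is idle. -/
def amplificationAdversary {n : ℕ} (hn : 0 < n) (θ : ℝ) (m : ℕ) : Adversary n where
  k := 2
  query := ![[], [.single ⟨0, hn⟩ (rotation θ)]]
  challenge := [.single ⟨0, hn⟩ pauliX]
  r := 2
  a := 1
  load := ![.response 1, .blank]
  load_once := by
    intro i j s
    fin_cases i <;> fin_cases j <;> simp
  circuit := .gate (.single (.inr 0) pauliX) ::
    (List.replicate m [.reflOut 0 0 0, .reflOut 0 0 1]).flatten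
  out := 0

section Amplification

variable {n : ℕ} (hn : 0 < n)

/-- In the plane of the responses, `m` rounds are a rotation by `m * (2 * θ)`; `w` collects the
amplitudes of the idle register. -/
theorem amplification_foldl {f' g' : Ket (Fin n)} (h' : OrthoPair f' g') (θ : ℝ)
    (qs rs : Fin 2 → Ket (Fin n)) (hr : rs 1 = comb f' g' (Real.cos θ) (Real.sin θ))
    (hr' : rs 0 = f') (w : (Fin n → Bool) → ℂ) (m : ℕ) (α : ℝ) :
    ((List.replicate m [.reflOut 0 0 0, .reflOut 0 0 1]).flatten :
      List (Instr n 2 2 1)).foldl (fun ψ c => c.apply qs rs ψ)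
      (memState fun y b => comb f' g' (if b then w y * Real.cos α else 0)
        (if b then w y * Real.sin α else 0)) =
    memState fun y b => comb f' g' (if b then w y * Real.cos (α + m * (2 * θ)) else 0)
        (if b then w y * Real.sin (α + m * (2 * θ)) else 0) := by
  induction m generalizing α with
  | zero => simp
  | succ m ih =>
    rw [List.replicate_succ, List.flatten_cons, List.foldl_append]
    -- the first reflection takes the angle `α` to `π - α`, the second takes `β` to `2 θ + π - β`
    have e : ([.reflOut 0 0 0, .reflOut 0 0 1] : List (Instr n 2 2 1)).foldl
        (fun ψ c => c.apply qs rs ψ)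
        (memState fun y b => comb f' g' (if b then w y * Real.cos α else 0)
          (if b then w y * Real.sin α else 0)) =
        memState fun y b => comb f' g' (if b then w y * Real.cos (α + 2 * θ) else 0)
          (if b then w y * Real.sin (α + 2 * θ) else 0) := by
      simp only [List.foldl_cons, List.foldl_nil, memState_reflOut]
      congr 1
      funext y b
      cases b
      · simp
      · have hcs : (Real.cos θ : ℂ) ^ 2 + (Real.sin θ : ℂ) ^ 2 = 1 := by
          exact_mod_cast Real.cos_sq_add_sin_sq θ
        simp only [if_true, hr, hr', h'.reflect_left_comb, h'.reflect_comb, Real.cos_add,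
          Real.sin_add, Real.cos_two_mul, Real.sin_two_mul, Complex.ofReal_sub,
          Complex.ofReal_add, Complex.ofReal_mul, Complex.ofReal_pow, Complex.ofReal_one,
          Complex.ofReal_ofNat]
        congr 1
        · ring
        · linear_combination (-2 * w y * Real.sin α) * hcs
    rw [e, ih]
    have : α + 2 * θ + m * (2 * θ) = α + (m + 1 : ℕ) * (2 * θ) := by push_cast; ring
    rw [this]

theorem amplification_queryKet_one (θ : ℝ) (m : ℕ) :
    (amplificationAdversary hn θ m).queryKet (1 : Fin 2) =
      comb (zeroKet (Fin n)) (oneKet hn) (Real.cos θ) (Real.sin θ) := prepare_rotation hn θ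

theorem amplification_challengeKet (θ : ℝ) (m : ℕ) :
    (amplificationAdversary hn θ m).challengeKet = oneKet hn := prepare_pauliX hn

theorem amplification_guessFidelity (θ : ℝ) (m : ℕ) (U : Unitary n) :
    (amplificationAdversary hn θ m).guessFidelity U = Real.sin ((2 * m + 1) * θ) ^ 2 := by
  have h' := (orthoPair_zero_one hn).map_unitary U
  have hr : (amplificationAdversary hn θ m).responseKet U (1 : Fin 2) = _ :=
    (congrArg _ (amplification_queryKet_one hn θ m)).trans (mulVec_comb _ _ _ _ _)
  have hinit : (amplificationAdversary hn θ m).initialKet U = memState fun y b =>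
      if b then 0 else zeroKet (Fin n) y •
        (amplificationAdversary hn θ m).responseKet U (1 : Fin 2) := by
    refine Eq.trans (funext fun x => ?_) (memState_initial _ _)
    exact congrArg (· * _) (Fin.prod_univ_two _)
  have hX : (Instr.gate (.single (.inr 0) pauliX) : Instr n 2 2 1).apply
      (amplificationAdversary hn θ m).queryKet ((amplificationAdversary hn θ m).responseKet U)
      (memState fun y b => if b then 0 else zeroKet (Fin n) y •
        (amplificationAdversary hn θ m).responseKet U (1 : Fin 2)) =
      memState fun y b => comb ((U : Matrix (Fin n → Bool) (Fin n → Bool) ℂ) *ᵥ zeroKet (Fin n))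
        ((U : Matrix (Fin n → Bool) (Fin n → Bool) ℂ) *ᵥ oneKet hn)
        (if b then zeroKet (Fin n) y * Real.cos θ else 0)
        (if b then zeroKet (Fin n) y * Real.sin θ else 0) := by
    refine (memState_single _ _ _ _).trans ?_
    rw [hr]
    congr 1
    funext y b
    cases b
    · simp [pauliX_apply, comb]
    · simp [pauliX_apply, comb_smul]
  have hfin : (amplificationAdversary hn θ m).finalKet U = _ :=
    (congrArg (List.foldl (fun ψ c => Instr.apply (amplificationAdversary hn θ m).queryKet
      ((amplificationAdversary hn θ m).responseKet U) c ψ) · _) ((congrArg _ hinit).trans hX)).trans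
      (amplification_foldl h' θ _ _ hr rfl (zeroKet (Fin n)) m θ)
  have hfid := fidelity_memState h' hfin
  unfold Adversary.guessFidelity
  rw [amplification_challengeKet]
  refine Eq.trans hfid ?_
  have hα : θ + m * (2 * θ) = (2 * m + 1) * θ := by ring
  have h1 : ∑ y, Complex.normSq (zeroKet (Fin n) y) = 1 := by
    simp [zeroKet, basisKet, Pi.single_apply, apply_ite Complex.normSq]
  simp only [hα, Fintype.sum_bool, if_true, Bool.false_eq_true, if_false, map_zero, add_zero,
    map_mul, Complex.normSq_ofReal, ← Finset.sum_mul, h1]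
  ring

theorem amplification_distinguishable {θ μ : ℝ} (m : ℕ) (h1 : μ ≤ 1)
    (hθ : Real.sin θ ^ 2 ≤ 1 - μ) : (amplificationAdversary hn θ m).Distinguishable μ := by
  have h := orthoPair_zero_one hn
  have key : ∀ s : Fin 2, fidelity (amplificationAdversary hn θ m).challengeKet
      (density ((amplificationAdversary hn θ m).queryKet s)) ≤ 1 - μ := by
    intro s
    rw [fidelity_density, amplification_challengeKet]
    fin_cases s
    · change Complex.normSq (star (oneKet hn) ⬝ᵥ zeroKet (Fin n)) ≤ _
      rw [h.orthogonal', map_zero]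
      linarith
    · have e : (amplificationAdversary hn θ m).queryKet (1 : Fin 2) = _ :=
        amplification_queryKet_one hn θ m
      refine (congrArg (fun v => Complex.normSq (star (oneKet hn) ⬝ᵥ v)) e).trans_le ?_
      simpa only [h.right_dotProduct_comb, Complex.normSq_ofReal, ← sq] using hθ
  exact key

/-- The angle for which `m` rounds of amplification are exact. -/
def amplificationAngle (m : ℕ) : ℝ := Real.pi / (2 * (2 * m + 1))

theorem sin_amplificationAngle (m : ℕ) :
    Real.sin ((2 * m + 1) * amplificationAngle m) ^ 2 = 1 := by
  have : (2 * m + 1) * amplificationAngle m = Real.pi / 2 := by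
    unfold amplificationAngle; field_simp
  simp [this]

theorem sin_sq_amplificationAngle_le {m : ℕ} (hm : 0 < m) :
    Real.sin (amplificationAngle m) ^ 2 ≤ 1 / m := by
  have hm' : (1 : ℝ) ≤ m := by exact_mod_cast hm
  have h0 : 0 ≤ amplificationAngle m := by unfold amplificationAngle; positivity
  have h1 : amplificationAngle m ≤ 1 / m := by
    unfold amplificationAngle
    rw [div_le_div_iff₀ (by positivity) (by positivity)]
    nlinarith [Real.pi_le_four]
  have h2 : (1 : ℝ) / m ≤ 1 := by rw [div_le_one (by positivity)]; exact hm'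
  have h3 : |Real.sin (amplificationAngle m)| ≤ amplificationAngle m := by
    simpa [abs_of_nonneg h0] using Real.abs_sin_le_abs (x := amplificationAngle m)
  calc Real.sin (amplificationAngle m) ^ 2 = |Real.sin (amplificationAngle m)| ^ 2 :=
        (sq_abs _).symm
    _ ≤ (1 / m) ^ 2 := by gcongr; exact h3.trans h1
    _ ≤ 1 / m := by
        have : 0 ≤ (1 : ℝ) / m := by positivity
        nlinarith

open Classical in
/-- The angle of the attack with `m` rounds at parameter `μ`: the exact one if the challenge is
then distinguishable, and otherwise `0`, for which the challenge is orthogonal to the queries. -/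
def attackAngle (m : ℕ) (μ : ℝ) : ℝ :=
  if Real.sin (amplificationAngle m) ^ 2 ≤ 1 - μ then amplificationAngle m else 0

theorem sin_sq_attackAngle_le (m : ℕ) {μ : ℝ} (h : μ ≤ 1) :
    Real.sin (attackAngle m μ) ^ 2 ≤ 1 - μ := by
  unfold attackAngle
  split_ifs with hs
  · exact hs
  · simpa using h

end Amplification

/-! ### Costs -/

theorem PolyBounded.add {f g : ℕ → ℕ} (hf : PolyBounded f) (hg : PolyBounded g) :
    PolyBounded fun l => f l + g l := by
  obtain ⟨p, hp⟩ := hf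
  obtain ⟨q, hq⟩ := hg
  exact ⟨p + q, fun l => by simpa using add_le_add (hp l) (hq l)⟩

theorem PolyBounded.mul {f g : ℕ → ℕ} (hf : PolyBounded f) (hg : PolyBounded g) :
    PolyBounded fun l => f l * g l := by
  obtain ⟨p, hp⟩ := hf
  obtain ⟨q, hq⟩ := hg
  exact ⟨p * q, fun l => by simpa using Nat.mul_le_mul (hp l) (hq l)⟩

theorem polyBounded_const (c : ℕ) : PolyBounded fun _ => c :=
  ⟨Polynomial.C c, fun l => by simp⟩

theorem polyBounded_pow (c : ℕ) : PolyBounded fun l => l ^ c :=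
  ⟨Polynomial.X ^ c, fun l => by simp⟩

theorem emulation_cost {n : ℕ} (hn : 0 < n) (μ : ℝ) :
    (emulationAdversary hn μ).cost = 10 * n + 12 := by
  have : (emulationAdversary hn μ).cost = (n + 0 + (n + 1)) + (n + 1) + ((n + 1) + n) + 1 +
      ((emulationCircuit (1 : Fin 2) ![0] : List (Instr n 2 2 1)).map Instr.cost).sum := rfl
  rw [this, emulationCircuit_one]
  simp [Instr.cost]
  ring

theorem amplification_cost {n : ℕ} (hn : 0 < n) (θ : ℝ) (m : ℕ) :
    (amplificationAdversary hn θ m).cost = 5 * n + 4 + m * (2 * n + 2) := by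
  have : (amplificationAdversary hn θ m).cost = (n + 0 + (n + 1)) + (n + 1) + (n + n) + 1 +
      (List.map Instr.cost ((.gate (.single (.inr 0) pauliX) : Instr n 2 2 1) ::
        (List.replicate m [.reflOut 0 0 0, .reflOut 0 0 1]).flatten)).sum := rfl
  rw [this, List.map_cons, List.sum_cons, List.map_flatten, List.sum_flatten]
  simp [Instr.cost]
  ring

/-! ### The game -/

theorem QuantumTest.accept_one (T : QuantumTest) {κ₁ κ₂ : ℕ} (h₁ : 1 ≤ κ₁) (h₂ : 1 ≤ κ₂) :
    T.accept κ₁ κ₂ 1 = 1 :=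
  tendsto_nhds_unique (tendsto_pure_nhds _ _)
    ((T.tendsto_one κ₁ κ₂ h₁ h₂).mono_left (pure_le_nhdsWithin (by simp)))

/-- If the fidelity of the guess does not depend on the device, then the winning probability is the
acceptance probability of the test at this fidelity. -/
theorem winProb_eq {n : ℕ → ℕ} (P : UqPUF n) (T : QuantumTest) {l : ℕ} {μ : ℝ}
    {A : Adversary (n l)} (hA : A.Distinguishable μ) {F : ℝ} (hF : ∀ U, A.guessFidelity U = F)
    (κ₁ κ₂ : ℕ) : winProb P T l μ A κ₁ κ₂ = T.accept κ₁ κ₂ F := by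
  let _ := P.measurableSpace l
  have := P.isProbabilityMeasure l
  simp [winProb, if_pos hA, hF]

theorem frequently_of_not_negligible {f : ℕ → ℝ} (hf : ∀ l, 0 ≤ f l) (h : ¬ Negligible f) :
    ∃ (c : ℕ) (ε : ℝ), 0 < ε ∧ ∃ᶠ l : ℕ in atTop, ε ≤ (l : ℝ) ^ c * f l := by
  simp only [Negligible, Asymptotics.SuperpolynomialDecay, not_forall] at h
  obtain ⟨c, hc⟩ := h
  rw [Metric.tendsto_nhds] at hc
  push Not at hc
  obtain ⟨ε, hε, hc⟩ := hc
  refine ⟨c, ε, hε, hc.mono fun l hl => ?_⟩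
  rwa [Real.dist_eq, sub_zero, abs_of_nonneg (mul_nonneg (by positivity) (hf l))] at hl

theorem not_negligible_of_frequently_one {f : ℕ → ℝ} (h : ∃ᶠ l in atTop, f l = 1) :
    ¬ Negligible f := by
  intro hn
  have := hn 0
  simp only [pow_zero, one_mul] at this
  obtain ⟨l, hl, hl'⟩ := (h.and_eventually (this.eventually_lt_const one_pos)).exists
  linarith

theorem not_negligible_of_le {f g : ℕ → ℝ} (hf : ∀ l, 0 ≤ f l) (h : ¬ Negligible f)
    (C : ℝ) (hfg : ∀ᶠ l in atTop, f l ≤ C * g l) : ¬ Negligible g := by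
  intro hg
  refine h fun c => ?_
  have := (hg c).const_mul C
  rw [mul_zero] at this
  refine tendsto_of_tendsto_of_tendsto_of_le_of_le' tendsto_const_nhds this
    (Eventually.of_forall fun l => mul_nonneg (by positivity) (hf l)) ?_
  filter_upwards [hfg] with l hl
  calc (l : ℝ) ^ c * f l ≤ (l : ℝ) ^ c * (C * g l) := by gcongr
    _ = _ := by ring

/-- Amplification wins with certainty at infinitely many security parameters: if
`ε ≤ l ^ c * (1 - μ l)`, then `l ^ (c + 1)` rounds are exact for large `l`. -/
theorem exists_amplification_attack (n : ℕ → ℕ) (hn : ∀ l, 0 < n l) (hpoly : PolyBounded n)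
    (μ : ℕ → ℝ) (hμ1 : ∀ l, μ l ≤ 1) (hμ : ¬ Negligible (fun l => 1 - μ l)) :
    ∃ A : ∀ l, Adversary (n l), IsQPT A ∧ (∀ l, (A l).Distinguishable (μ l)) ∧
      ∀ (P : UqPUF n) (T : QuantumTest) (κ₁ κ₂ : ℕ → ℕ),
        (∀ l, 1 ≤ κ₁ l) → (∀ l, 1 ≤ κ₂ l) →
        ¬ Negligible (fun l => winProb P T l (μ l) (A l) (κ₁ l) (κ₂ l)) := by
  obtain ⟨c, ε, hε, hfreq⟩ := frequently_of_not_negligible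
    (fun l => sub_nonneg.2 (hμ1 l)) hμ
  have hdist : ∀ l, (amplificationAdversary (hn l) (attackAngle (l ^ (c + 1)) (μ l))
      (l ^ (c + 1))).Distinguishable (μ l) := fun l =>
    amplification_distinguishable (hn l) _ (hμ1 l) (sin_sq_attackAngle_le _ (hμ1 l))
  refine ⟨fun l => amplificationAdversary (hn l) (attackAngle (l ^ (c + 1)) (μ l)) (l ^ (c + 1)),
    ?_, hdist, fun P T κ₁ κ₂ h₁ h₂ => ?_⟩
  · simp only [IsQPT, amplification_cost]
    exact (((polyBounded_const 5).mul hpoly).add (polyBounded_const 4)).add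
      ((polyBounded_pow (c + 1)).mul (((polyBounded_const 2).mul hpoly).add (polyBounded_const 2)))
  · refine not_negligible_of_frequently_one ?_
    refine (hfreq.and_eventually ((eventually_ge_atTop 1).and
      (tendsto_natCast_atTop_atTop.eventually_ge_atTop (1 / ε)))).mono ?_
    rintro l ⟨hl, hl1, hlε⟩
    have hl0 : (0 : ℝ) < l := by exact_mod_cast hl1
    -- the weight of the challenge in the second query is at most `l ^ (-(c + 1)) ≤ ε * l ^ (-c)`
    have hangle : Real.sin (amplificationAngle (l ^ (c + 1))) ^ 2 ≤ 1 - μ l := by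
      refine (sin_sq_amplificationAngle_le (by positivity)).trans ?_
      have h1 : 1 ≤ l * ε := by rwa [div_le_iff₀ hε] at hlε
      rw [div_le_iff₀ (by positivity)]
      push_cast
      calc 1 ≤ l * ε := h1
        _ ≤ l * ((l : ℝ) ^ c * (1 - μ l)) := by gcongr
        _ = _ := by ring
    rw [winProb_eq P T (hdist l) (F := 1), T.accept_one (h₁ l) (h₂ l)]
    intro U
    rw [amplification_guessFidelity, attackAngle, if_pos hangle, sin_amplificationAngle]

end QPUF

end

theorem theorem4 (n : ℕ → ℕ) (hn : ∀ l, 0 < n l) (hpoly : QPUF.PolyBounded n)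
    (μ : ℕ → ℝ) (hμ0 : ∀ l, 0 ≤ μ l) (hμ1 : ∀ l, μ l ≤ 1)
    (hμ : ¬ QPUF.Negligible (fun l => 1 - μ l)) :
    -- a QPT adversary wins against every UqPUF, for every test and all numbers of copies
    (∃ A : ∀ l, QPUF.Adversary (n l), QPUF.IsQPT A ∧
      (∀ l, (A l).Distinguishable (μ l)) ∧
      ∀ (P : QPUF.UqPUF n) (T : QPUF.QuantumTest) (κ₁ κ₂ : ℕ → ℕ),
        (∀ l, 1 ≤ κ₁ l) → (∀ l, 1 ≤ κ₂ l) →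
        ¬ QPUF.Negligible (fun l => QPUF.winProb P T l (μ l) (A l) (κ₁ l) (κ₂ l))) ∧
    -- the emulation attack is a QPT adversary
    QPUF.IsQPT (fun l => QPUF.emulationAdversary (hn l) (μ l)) ∧
    -- its queries `φ₁`, `φ₂` and its challenge `φ₃`
    (∀ l, ∃ φ₁ φ₃ : QPUF.Ket (Fin (n l)),
      star φ₁ ⬝ᵥ φ₁ = 1 ∧ star φ₃ ⬝ᵥ φ₃ = 1 ∧ star φ₁ ⬝ᵥ φ₃ = 0 ∧
      (QPUF.emulationAdversary (hn l) (μ l)).queryKet (0 : Fin 2) = φ₁ ∧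
      (μ l ≤ 1 / 2 → (QPUF.emulationAdversary (hn l) (μ l)).queryKet (1 : Fin 2) =
        ((1 / √2 : ℝ) : ℂ) • (φ₁ + φ₃)) ∧
      (1 / 2 < μ l → (QPUF.emulationAdversary (hn l) (μ l)).queryKet (1 : Fin 2) =
        ((√(μ l) : ℝ) : ℂ) • φ₁ + ((√(1 - μ l) : ℝ) : ℂ) • φ₃) ∧
      (QPUF.emulationAdversary (hn l) (μ l)).challengeKet = φ₃) ∧
    (∀ l, (QPUF.emulationAdversary (hn l) (μ l)).Distinguishable (μ l)) ∧
    -- the fidelity of its guess, for every unitary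
    (∀ l (U : QPUF.Unitary (n l)),
      (μ l ≤ 1 / 2 → (QPUF.emulationAdversary (hn l) (μ l)).guessFidelity U = 1) ∧
      (1 / 2 < μ l → (1 - μ l) * (1 + 4 * μ l * (1 - μ l)) ≤
        (QPUF.emulationAdversary (hn l) (μ l)).guessFidelity U)) ∧
    -- its winning probability
    (∀ (P : QPUF.UqPUF n) (T : QPUF.QuantumTest) (l κ₁ κ₂ : ℕ), 1 ≤ κ₁ → 1 ≤ κ₂ →
      μ l ≤ 1 / 2 →
      QPUF.winProb P T l (μ l) (QPUF.emulationAdversary (hn l) (μ l)) κ₁ κ₂ = 1) ∧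
    (∀ T : QPUF.QuantumTest, ∃ K : ℝ → ℕ, ∀ (P : QPUF.UqPUF n) (κ₁ κ₂ : ℕ → ℕ),
      (∀ᶠ l in atTop, K (μ l) ≤ κ₁ l ∧ K (μ l) ≤ κ₂ l) →
      ¬ QPUF.Negligible (fun l =>
        QPUF.winProb P T l (μ l) (QPUF.emulationAdversary (hn l) (μ l)) (κ₁ l) (κ₂ l))) := by
  refine ⟨QPUF.exists_amplification_attack n hn hpoly μ hμ1 hμ, ?_, fun l => ?_,
    fun l => QPUF.emulation_distinguishable (hn l) (hμ1 l), fun l U => ⟨fun h => ?_, fun h => ?_⟩,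
    fun P T l κ₁ κ₂ h₁ h₂ h => ?_, fun T => ?_⟩
  · simp only [QPUF.IsQPT, QPUF.emulation_cost]
    exact ((QPUF.polyBounded_const 10).mul hpoly).add (QPUF.polyBounded_const 12)
  · have h := QPUF.orthoPair_zero_one (hn l)
    refine ⟨_, _, h.1, h.2, h.3, rfl, fun hm => ?_, fun hm => ?_, QPUF.emulation_challengeKet _ _⟩
    · refine (QPUF.emulation_queryKet_one (hn l) (hμ1 l)).trans ?_
      rw [QPUF.weight, if_pos hm, QPUF.comb, smul_add, show (1 : ℝ) - 1 / 2 = 1 / 2 by norm_num,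
        Real.sqrt_div zero_le_one, Real.sqrt_one]
    · refine (QPUF.emulation_queryKet_one (hn l) (hμ1 l)).trans ?_
      rw [QPUF.weight, if_neg hm.not_ge, QPUF.comb]
  · rw [QPUF.emulation_guessFidelity (hn l) (hμ1 l), QPUF.emulationFidelity_of_le h]
  · rw [QPUF.emulation_guessFidelity (hn l) (hμ1 l)]
    exact QPUF.le_emulationFidelity h (hμ1 l)
  · rw [QPUF.winProb_eq P T (QPUF.emulation_distinguishable (hn l) (hμ1 l))
      (QPUF.emulation_guessFidelity (hn l) (hμ1 l)), QPUF.emulationFidelity_of_le h,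
      T.accept_one h₁ h₂]
  · -- the fidelity does not depend on the device, so pointwise convergence of the test suffices
    have hK : ∀ m : ℝ, ∃ K : ℕ, 0 ≤ m → m < 1 → ∀ κ₁ κ₂, K ≤ κ₁ → K ≤ κ₂ →
        (1 - m) / 2 ≤ T.accept κ₁ κ₂ (QPUF.emulationFidelity (QPUF.weight m)) := by
      intro m
      by_cases hm : 0 ≤ m ∧ m < 1
      · have hF := QPUF.one_sub_le_emulationFidelity hm.1 hm.2.le
        have hlim := T.tendsto_fidelity _ (QPUF.emulationFidelity_weight_mem hm.1 hm.2.le)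
        obtain ⟨⟨a, b⟩, hab⟩ := eventually_atTop.1 (hlim.eventually_const_le
          (show (1 - m) / 2 < _ by linarith [hm.2]))
        exact ⟨max a b, fun _ _ κ₁ κ₂ h₁ h₂ => hab (κ₁, κ₂)
          ⟨(le_max_left _ _).trans h₁, (le_max_right _ _).trans h₂⟩⟩
      · exact ⟨0, fun h0 h1 => absurd ⟨h0, h1⟩ hm⟩
    choose K hK using hK
    refine ⟨K, fun P κ₁ κ₂ hκ => QPUF.not_negligible_of_le
      (fun l => sub_nonneg.2 (hμ1 l)) hμ 2 ?_⟩
    filter_upwards [hκ] with l hl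
    rw [QPUF.winProb_eq P T (QPUF.emulation_distinguishable (hn l) (hμ1 l))
      (QPUF.emulation_guessFidelity (hn l) (hμ1 l))]
    rcases (hμ1 l).lt_or_eq with h1 | h1
    · linarith [hK (μ l) (hμ0 l) h1 _ _ hl.1 hl.2]
    · have h0 := (T.accept_mem (κ₁ l) (κ₂ l) _
        (QPUF.emulationFidelity_weight_mem (hμ0 l) (hμ1 l))).1
      linarith
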